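/- Let $X$ be a (complex) elliptic curve, $p\in X$ a point, and $E$ a holomorphic vector bundle of rank $3$ and degree $0$ on $X$ (for instance with trivial determinant). Let $E_\bullet$ be a full flag $0\subsetneq E_{p,1}\subsetneq E_{p,2}\subsetneq E_{p,3}=E_p$ in the fibre at $p$, and let $\boldsymbol\mu=(\mu_1,\mu_2,\mu_3)\in\mathbb R^3$ denote parabolic weights, i.e. $\mu_3\le\mu_2\le\mu_1$, $\mu_1-\mu_3<1$, $\mu_1+\mu_2+\mu_3=0$. A subbundle $S\subset E$ carries the induced flag in $S_p$ formed by the distinct nonzero subspaces $S_p\cap E_{p,j}$, where a step $W$ of this flag has the weight $\mu_j$ with $W\subseteq E_{p,j}$, $W\not\subseteq E_{p,j-1}$ (with $E_{p,0}=0$); its parabolic degree $\mathrm{pardeg}(S)$ is $\deg S$ plus the sum of these weights, and its parabolic slope is $\mathrm{pardeg}(S)/\mathrm{rk}(S)$. The parabolic slope of $(E,E_\bullet)$ is $(\deg E+\mu_1+\mu_2+\mu_3)/3$. The parabolic bundle $(E,E_\bullet)$ is stable (semistable) for $\boldsymbol\mu$ if every subbundle of rank $1$ or $2$ has parabolic slope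 $<$ (resp. $\le$) that of $(E,E_\bullet)$; it is strictly semistable if it is semistable but not stable, and unstable if it is not semistable. Below, $L$ runs over the rank $1$ subbundles and $F$ over the rank $2$ subbundles of $E$ of degree $0$. 1. If $E$ is (slope-)semistable as a vector bundle, $L_p\not\subseteq E_{p,2}$ for all $L$, and $E_{p,1}\not\subseteq F_p$ for all $F$, then $(E,E_\bullet)$ is stable for all weights with $\mu_2\ne0$. 2. If $E$ is semistable, $L_p\not\subseteq E_{p,2}$ for all $L$, $E_{p,1}\subseteq F_p$ for some $F$, and $F_p\ne E_{p,2}$ for all $F$, then for all weights $(E,E_\bullet)$ is stable if and only if $\mu_2>0$, and strictly semistable if and only if $\mu_2=0$. 3. If $E$ is semistable, $L_p\ne E_{p,1}$ for all $L$, $L_p\subseteq E_{p,2}$ for some $L$, and $E_{p,1}\not\subseteq F_p$ for all $F$, then for all weights $(E,E_\bullet)$ is stable if and only if $\mu_2<0$, and strictly semistable if and only if $\mu_2=0$. 4. If $L_p\ne E_{p,1}$ for all $L$, $L_p\subseteq E_{p,2}$ for some $L$, $E_{p,1}\subseteq F_p$ for some $F$, and $F_p\ne E_{p,2}$ for all $F$,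 then for all weights $(E,E_\bullet)$ is unstable whenever $\mu_2\neq0$; if moreover $E$ is semistable, then $(E,E_\bullet)$ is strictly semistable if and only if $\mu_2=0$. 5. If $L_p=E_{p,1}$ for some $L$ or $F_p=E_{p,2}$ for some $F$, then $(E,E_\bullet)$ is unstable for all weights $(\mu_1,\mu_2,\mu_3)\neq(0,0,0)$. Consequently (with no semistability assumption on $E$) there are two chambers, $\mu_2>0$ and $\mu_2<0$, separated by the wall $\mu_2=0$: for $\mu_2\ne0$, $(E,E_\bullet)$ is semistable if and only if it is stable; and if the $\mu_2$-entries of two weights are both positive or both negative, then $(E,E_\bullet)$ is stable for one of these weights if and only if it is for the other. -/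

import Mathlib

open scoped Manifold ContDiff Topology

noncomputable section

namespace ParBundle

open Bundle

/-! ### Elliptic curves -/

/-- A Riemann surface `X` is a (complex) elliptic curve if it is biholomorphic to a complex torus
`ℂ / Λ`: there is a surjective locally biholomorphic map `ℂ → X` whose fibres are exactly the
cosets of a lattice `Λ = ℤ ω₁ + ℤ ω₂` with `ω₁, ω₂` linearly independent over `ℝ`.
(Such an `X` is automatically compact, connected and Hausdorff.) -/
def IsEllipticCurve (X : Type*) [TopologicalSpace X] [ChartedSpace ℂ X] : Prop :=
  ∃ (Λ : PeriodPair) (q : ℂ → X), IsLocalDiffeomorph 𝓘(ℂ, ℂ) 𝓘(ℂ, ℂ) ω q ∧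
    Function.Surjective q ∧ ∀ z w : ℂ, q z = q w ↔ z - w ∈ Λ.lattice

/-! ### Holomorphic subbundles -/

section Bundles

variable {X : Type*} [TopologicalSpace X] [ChartedSpace ℂ X]

section Subbundle

variable (F : Type*) [NormedAddCommGroup F] [NormedSpace ℂ F]
  (V : X → Type*) [TopologicalSpace (TotalSpace F V)]
  [∀ x, AddCommGroup (V x)] [∀ x, Module ℂ (V x)] [∀ x, TopologicalSpace (V x)]
  [FiberBundle F V]

variable {V} in
/-- The sections `s 0, …, s (r - 1)` of `V` are holomorphic on `U` and for each `x ∈ U` their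
values form a basis of the subspace `W x` of the fibre `V x`. -/
structure IsHolomorphicFrameOn (W : ∀ x, Submodule ℂ (V x)) {r : ℕ}
    (s : Fin r → ∀ x, V x) (U : Set X) : Prop where
  contMDiffOn : ∀ i, ContMDiffOn 𝓘(ℂ, ℂ) (𝓘(ℂ, ℂ).prod 𝓘(ℂ, F)) ω
    (fun x => TotalSpace.mk' F x (s i x)) U
  linearIndependent : ∀ x ∈ U, LinearIndependent ℂ (fun i => s i x)
  span_eq : ∀ x ∈ U, Submodule.span ℂ (Set.range fun i => s i x) = W x

/-- A holomorphic subbundle of `V`: a family of subspaces of the fibres which has, near every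
point of the base, a holomorphic frame of a fixed length (the rank). -/
structure Subbundle where
  /-- The fibres of the subbundle. -/
  fiber : ∀ x, Submodule ℂ (V x)
  /-- The rank of the subbundle. -/
  rank : ℕ
  exists_frame : ∀ x₀, ∃ U : Set X, IsOpen U ∧ x₀ ∈ U ∧
    ∃ s : Fin rank → ∀ x, V x, IsHolomorphicFrameOn F fiber s U

/-- `V` as a subbundle of itself. -/
def Subbundle.top [VectorBundle ℂ F V] [ContMDiffVectorBundle ω F V 𝓘(ℂ, ℂ)]
    [FiniteDimensional ℂ F] : Subbundle F V where
  fiber _ := ⊤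
  rank := Module.finrank ℂ F
  exists_frame x₀ := by
    have h := (trivializationAt F V x₀).isLocalFrameOn_localFrame_baseSet 𝓘(ℂ, ℂ) ω
      (Module.finBasis ℂ F)
    exact ⟨_, (trivializationAt F V x₀).open_baseSet, mem_baseSet_trivializationAt F V x₀, _,
      h.contMDiffOn, fun x hx => h.linearIndependent hx,
      fun x hx => top_le_iff.1 (h.generating hx)⟩

end Subbundle

/-! ### The degree -/

/-- `f` is meromorphic at `x₀`, read in the chart at `x₀`. -/
def MeromorphicAtPoint (f : X → ℂ) (x₀ : X) : Prop :=
  MeromorphicAt (f ∘ (chartAt ℂ x₀).symm) (chartAt ℂ x₀ x₀)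

/-- The order of vanishing at `x₀` of a meromorphic function, read in the chart at `x₀`. -/
def meromorphicOrderAtPoint (f : X → ℂ) (x₀ : X) : WithTop ℤ :=
  meromorphicOrderAt (f ∘ (chartAt ℂ x₀).symm) (chartAt ℂ x₀ x₀)

variable {F : Type*} [NormedAddCommGroup F] [NormedSpace ℂ F]
  {V : X → Type*} [TopologicalSpace (TotalSpace F V)]
  [∀ x, AddCommGroup (V x)] [∀ x, Module ℂ (V x)] [∀ x, TopologicalSpace (V x)]
  [FiberBundle F V]

/-- `σ 0, …, σ (r - 1)` are meromorphic sections near `x₀` of the rank `r` subbundle `S`, and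
`σ 0 ∧ ⋯ ∧ σ (r - 1)` is a meromorphic section of `det S`, not identically zero near `x₀`, whose
order at `x₀` is `n`: in some holomorphic frame `s` of `S` around `x₀` the sections are given by a
matrix `A` of functions meromorphic at `x₀` such that `det A` has order `n` at `x₀`. -/
def Subbundle.DetOrderAt (S : Subbundle F V) (σ : Fin S.rank → ∀ x, V x) (x₀ : X) (n : ℤ) : Prop :=
  ∃ (U : Set X) (s : Fin S.rank → ∀ x, V x) (A : X → Matrix (Fin S.rank) (Fin S.rank) ℂ),
    IsOpen U ∧ x₀ ∈ U ∧ IsHolomorphicFrameOn F S.fiber s U ∧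
    (∀ i j, MeromorphicAtPoint (fun x => A x i j) x₀) ∧
    (∀ᶠ x in 𝓝[≠] x₀, ∀ j, σ j x = ∑ i, A x i j • s i x) ∧
    meromorphicOrderAtPoint (fun x => (A x).det) x₀ = (n : WithTop ℤ)

/-- `d` is the degree of the divisor `D` of `σ 0 ∧ ⋯ ∧ σ (r - 1)` for a global meromorphic
frame `σ` of `S`. -/
def Subbundle.HasDegree (S : Subbundle F V) (d : ℤ) : Prop :=
  ∃ (σ : Fin S.rank → ∀ x, V x) (D : X →₀ ℤ),
    (∀ x, S.DetOrderAt σ x (D x)) ∧ d = D.sum fun _ n => n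

open Classical in
/-- The degree of a holomorphic subbundle over a compact Riemann surface: the degree of the divisor
of the determinant of any meromorphic frame. (On a compact connected Riemann surface such frames
exist, and the degree does not depend on the frame.) -/
def Subbundle.degree (S : Subbundle F V) : ℤ :=
  if h : ∃ d, S.HasDegree d then h.choose else 0

/-- The slope, degree over rank. -/
def Subbundle.slope (S : Subbundle F V) : ℝ := (S.degree : ℝ) / (S.rank : ℝ)

variable (F V) in
/-- The subbundles of `V` of rank `r` and degree `0`. -/
def degreeZeroSubbundles (r : ℕ) : Set (Subbundle F V) := {S | S.rank = r ∧ S.degree = 0}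

section Stability

variable [VectorBundle ℂ F V] [ContMDiffVectorBundle ω F V 𝓘(ℂ, ℂ)] [FiniteDimensional ℂ F]

variable (F V) in
/-- The degree of the bundle `V`. -/
def bundleDegree : ℤ := (Subbundle.top F V).degree

variable (F V) in
/-- Slope semistability of the bundle `V`. -/
def IsSemistable : Prop :=
  ∀ S : Subbundle F V, 0 < S.rank → S.rank < Module.finrank ℂ F →
    S.slope ≤ (Subbundle.top F V).slope

end Stability

end Bundles

/-! ### Parabolic structures in rank three -/

/-- A full flag `0 ⊊ E₁ ⊊ E₂ ⊊ E₃ = W` in a (three-dimensional) vector space `W`.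
The step `Eⱼ` is `step (j - 1)`. -/
structure FullFlag (W : Type*) [AddCommGroup W] [Module ℂ W] where
  /-- The steps of the flag. -/
  step : Fin 3 → Submodule ℂ W
  bot_lt : ⊥ < step 0
  strictMono : StrictMono step
  eq_top : step 2 = ⊤

namespace FullFlag

variable {W : Type*} [AddCommGroup W] [Module ℂ W]

/-- The subspace `E₁` of the flag. -/
abbrev E₁ (E : FullFlag W) : Submodule ℂ W := E.step 0

/-- The subspace `E₂` of the flag. -/
abbrev E₂ (E : FullFlag W) : Submodule ℂ W := E.step 1

open Classical in
/-- The flag induced on a subspace `W'`: the nonzero subspaces `W' ∩ Eⱼ`, without repetitions. -/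
def induced (E : FullFlag W) (W' : Submodule ℂ W) : Finset (Submodule ℂ W) :=
  (Finset.univ.image fun j => W' ⊓ E.step j).erase ⊥

open Classical in
/-- The least `j` with `W' ⊆ Eⱼ`. -/
def level (E : FullFlag W) (W' : Submodule ℂ W) : Fin 3 :=
  (Finset.univ.filter fun j => W' ≤ E.step j).min' ⟨2, by simp [E.eq_top]⟩

end FullFlag

/-- Parabolic weights `(μ₁, μ₂, μ₃)`; the weight `μⱼ` is `wt (j - 1)`. -/
structure Weights where
  /-- The weights. -/
  wt : Fin 3 → ℝ
  antitone : Antitone wt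
  sub_lt_one : wt 0 - wt 2 < 1
  sum_eq_zero : ∑ i, wt i = 0

namespace Weights

/-- The weight `μ₂`. -/
abbrev μ₂ (μ : Weights) : ℝ := μ.wt 1

end Weights

section Parabolic

variable {X : Type*} [TopologicalSpace X] [ChartedSpace ℂ X]
  {F : Type*} [NormedAddCommGroup F] [NormedSpace ℂ F]
  {V : X → Type*} [TopologicalSpace (TotalSpace F V)]
  [∀ x, AddCommGroup (V x)] [∀ x, Module ℂ (V x)] [∀ x, TopologicalSpace (V x)]
  [FiberBundle F V] {p : X}

/-- The parabolic degree of a subbundle with its induced parabolic structure at `p`: each step `W'`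
of the induced flag carries the weight `μⱼ` with `W' ⊆ Eⱼ` but `W' ⊄ Eⱼ₋₁`. -/
def Subbundle.parDegree (S : Subbundle F V) (E : FullFlag (V p)) (μ : Weights) : ℝ :=
  (S.degree : ℝ) + ∑ W' ∈ E.induced (S.fiber p), μ.wt (E.level W')

/-- The parabolic slope of a subbundle with its induced parabolic structure. -/
def Subbundle.parSlope (S : Subbundle F V) (E : FullFlag (V p)) (μ : Weights) : ℝ :=
  S.parDegree E μ / (S.rank : ℝ)

variable [VectorBundle ℂ F V] [ContMDiffVectorBundle ω F V 𝓘(ℂ, ℂ)] [FiniteDimensional ℂ F]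

variable (F V) in
/-- The parabolic slope of the parabolic bundle itself, `(deg + μ₁ + μ₂ + μ₃) / rank`. -/
def bundleParSlope (μ : Weights) : ℝ :=
  ((bundleDegree F V : ℝ) + ∑ i, μ.wt i) / (Module.finrank ℂ F : ℝ)

variable (F) in
/-- Parabolic stability of `V` with the flag `E` in the fibre at `p` and the weights `μ`. -/
def IsParStable (E : FullFlag (V p)) (μ : Weights) : Prop :=
  ∀ S : Subbundle F V, 0 < S.rank → S.rank < Module.finrank ℂ F →
    S.parSlope E μ < bundleParSlope F V μ

variable (F) in
/-- Parabolic semistability. -/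
def IsParSemistable (E : FullFlag (V p)) (μ : Weights) : Prop :=
  ∀ S : Subbundle F V, 0 < S.rank → S.rank < Module.finrank ℂ F →
    S.parSlope E μ ≤ bundleParSlope F V μ

variable (F) in
/-- Semistable but not stable. -/
def IsParStrictlySemistable (E : FullFlag (V p)) (μ : Weights) : Prop :=
  IsParSemistable F E μ ∧ ¬ IsParStable F E μ

variable (F) in
/-- Unstable means not semistable. -/
def IsParUnstable (E : FullFlag (V p)) (μ : Weights) : Prop := ¬ IsParSemistable F E μ

end Parabolic

end ParBundle

end

/-! Everything reduces to signs of weights. The parabolic slope of the whole bundle is zero, and the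
parabolic degree of a proper subbundle `S` is the integer `S.degree` plus a weight of absolute value
less than one. A nonzero degree therefore decides the sign by itself: parabolic stability is
ordinary semistability together with negative weights on degree zero subbundles (`isParStable_iff`),
and `isParSemistable_iff` is the analogue with nonpositive weights.

By linear algebra in the fibre at `p` (`weight_cases`), a line has weight μ₁, μ₂ or μ₃ and a plane
-μ₃, -μ₂ or -μ₁, according to its position relative to the flag. For nonzero weights μ₁ > 0 > μ₃, so
only the positions of weight ±μ₂ have a sign that can vary. The positions excluded or realised by
degree zero subbundles then give the five cases, and the signs of all six values depend only on the
chamber of μ₂. -/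

open scoped Manifold ContDiff Topology

namespace ParBundle

open Bundle

/-! ### Linear algebra of a full flag and the weights of subspaces. -/

namespace FullFlag

section Weight

variable {W : Type*} [AddCommGroup W] [Module ℂ W] (E : FullFlag W)

/-- The sum of the weights of the steps of the flag induced on a subspace. -/
noncomputable def weight (μ : Weights) (W' : Submodule ℂ W) : ℝ :=
  ∑ U ∈ E.induced W', μ.wt (E.level U)

theorem level_eq {W' : Submodule ℂ W} {j : Fin 3} (h : W' ≤ E.step j)
    (h' : ∀ i < j, ¬ W' ≤ E.step i) : E.level W' = j := by
  classical
  unfold level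
  refine le_antisymm (Finset.min'_le _ _ (by simpa using h)) (Finset.le_min' _ _ _ ?_)
  intro i hi
  by_contra hlt
  exact h' i (not_le.1 hlt) (by simpa using hi)

theorem mem_induced {W' U : Submodule ℂ W} :
    U ∈ E.induced W' ↔ U ≠ ⊥ ∧ (U = W' ⊓ E.step 0 ∨ U = W' ⊓ E.step 1 ∨ U = W') := by
  simp [induced, Fin.exists_fin_succ, E.eq_top, eq_comm]

theorem level_step (j : Fin 3) : E.level (E.step j) = j :=
  E.level_eq le_rfl fun _ hi => (E.strictMono hi).not_ge

theorem level_eq_one {U : Submodule ℂ W} (h : U ≤ E.E₂) (h' : ¬ U ≤ E.E₁) : E.level U = 1 :=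
  E.level_eq h fun i hi => by
    obtain rfl : i = 0 := by omega
    exact h'

theorem level_eq_two {U : Submodule ℂ W} (h : ¬ U ≤ E.E₂) : E.level U = 2 :=
  E.level_eq (by simp [E.eq_top]) fun i hi hle =>
    h (hle.trans (E.strictMono.monotone (by omega)))

variable {E} in
theorem weight_plane_eq_E₂ (μ : Weights) {W' : Submodule ℂ W}
    (h : W' = E.E₂) : E.weight μ W' = - μ.wt 2 := by
  subst h
  have h01 : E.E₁ < E.E₂ := E.strictMono (by decide)
  have hind : E.induced E.E₂ = {E.E₁, E.E₂} := by
    ext U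
    rw [mem_induced, Finset.mem_insert, Finset.mem_singleton, inf_eq_right.2 h01.le, inf_idem]
    constructor
    · rintro ⟨-, h | h | h⟩ <;> simp [h]
    · rintro (rfl | rfl)
      · exact ⟨E.bot_lt.ne', by simp⟩
      · exact ⟨(bot_le.trans_lt h01).ne', by simp⟩
  have hs := μ.sum_eq_zero
  rw [Fin.sum_univ_three] at hs
  rw [weight, hind, Finset.sum_pair h01.ne, E.level_step, E.level_step]
  linarith

variable {E} in
-- A line is an atom, so its induced flag has a single step.
theorem weight_line (μ : Weights) {W' : Submodule ℂ W} (h1 : Module.finrank ℂ W' = 1) :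
    E.weight μ W' = μ.wt (E.level W') := by
  have ha : IsAtom W' := Submodule.isAtom_iff_finrank_eq_one.2 h1
  have : E.induced W' = {W'} := by
    ext U
    rw [mem_induced, Finset.mem_singleton]
    constructor
    · rintro ⟨hne, h⟩
      have hle : U ≤ W' := by rcases h with rfl | rfl | rfl <;> simp
      exact (ha.le_iff.1 hle).resolve_left hne
    · rintro rfl
      exact ⟨ha.1, by simp⟩
  rw [weight, this, Finset.sum_singleton]

variable {E} in
theorem weight_line_not_le_E₂ (μ : Weights) {W' : Submodule ℂ W}
    (h1 : Module.finrank ℂ W' = 1) (h : ¬ W' ≤ E.E₂) : E.weight μ W' = μ.wt 2 := by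
  rw [weight_line μ h1, E.level_eq_two h]

variable [FiniteDimensional ℂ W]

theorem finrank_E₁_E₂ (h3 : Module.finrank ℂ W = 3) :
    Module.finrank ℂ E.E₁ = 1 ∧ Module.finrank ℂ E.E₂ = 2 := by
  have h0 := Submodule.finrank_lt_finrank_of_lt E.bot_lt
  have h1 := Submodule.finrank_lt_finrank_of_lt (E.strictMono (show (0 : Fin 3) < 1 by decide))
  have h2 := Submodule.finrank_lt_finrank_of_lt (E.strictMono (show (1 : Fin 3) < 2 by decide))
  rw [E.eq_top, finrank_top, h3] at h2
  rw [finrank_bot] at h0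
  change Module.finrank ℂ (E.step 0) = 1 ∧ Module.finrank ℂ (E.step 1) = 2
  omega

variable {E}

theorem weight_line_eq_E₁ (μ : Weights) (h3 : Module.finrank ℂ W = 3) {W' : Submodule ℂ W}
    (h : W' = E.E₁) : E.weight μ W' = μ.wt 0 := by
  subst h
  rw [weight_line μ (E.finrank_E₁_E₂ h3).1, level_step]

theorem weight_line_le_E₂ (μ : Weights) (h3 : Module.finrank ℂ W = 3) {W' : Submodule ℂ W}
    (h1 : Module.finrank ℂ W' = 1) (h : W' ≤ E.E₂) (h' : W' ≠ E.E₁) :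
    E.weight μ W' = μ.wt 1 := by
  rw [weight_line μ h1, E.level_eq_one h fun hle =>
    h' (Submodule.eq_of_le_of_finrank_eq hle (by rw [h1, (E.finrank_E₁_E₂ h3).1]))]

/-- Such a plane meets `E₂` in a line, so its induced flag consists of that line and the plane
itself; the plane, not lying in `E₂`, has weight μ₃. -/
theorem weight_plane (μ : Weights) (h3 : Module.finrank ℂ W = 3) {W' : Submodule ℂ W}
    (h2 : Module.finrank ℂ W' = 2) (h : W' ≠ E.E₂) :
    E.weight μ W' = μ.wt (E.level (W' ⊓ E.E₂)) + μ.wt 2 := by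
  have hW : ¬ W' ≤ E.E₂ := fun hle =>
    h (Submodule.eq_of_le_of_finrank_eq hle (by rw [h2, (E.finrank_E₁_E₂ h3).2]))
  have hlt : W' ⊓ E.E₂ < W' := inf_le_left.lt_of_ne fun he => hW (inf_eq_left.1 he)
  have hlt' := Submodule.finrank_lt_finrank_of_lt hlt
  have hsum := Submodule.finrank_sup_add_finrank_inf_eq W' E.E₂
  have hsup := Submodule.finrank_le (W' ⊔ E.E₂)
  rw [h3] at hsup
  rw [h2, (E.finrank_E₁_E₂ h3).2] at hsum
  -- The dimension formula in a 3-space gives dimension at least one, and properness in the plane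
  -- gives at most one.
  have ha : IsAtom (W' ⊓ E.E₂) := Submodule.isAtom_iff_finrank_eq_one.2 (by omega)
  have hind : E.induced W' = {W' ⊓ E.E₂, W'} := by
    ext U
    rw [mem_induced, Finset.mem_insert, Finset.mem_singleton]
    constructor
    · rintro ⟨hne, rfl | h | h⟩
      · exact .inl ((ha.le_iff.1 (inf_le_inf_left _
          (E.strictMono.monotone (by decide)))).resolve_left hne)
      · exact .inl h
      · exact .inr h
    · rintro (rfl | rfl)
      · exact ⟨ha.1, by simp⟩
      · exact ⟨(bot_le.trans_lt hlt).ne', by simp⟩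
  rw [weight, hind, Finset.sum_pair hlt.ne, E.level_eq_two hW]

theorem weight_plane_ge_E₁ (μ : Weights) (h3 : Module.finrank ℂ W = 3) {W' : Submodule ℂ W}
    (h2 : Module.finrank ℂ W' = 2) (h : E.E₁ ≤ W') (h' : W' ≠ E.E₂) :
    E.weight μ W' = - μ.wt 1 := by
  have h01 : E.E₁ < E.E₂ := E.strictMono (by decide)
  have hle : E.E₁ ≤ W' ⊓ E.E₂ := le_inf h h01.le
  have hlt : W' ⊓ E.E₂ < W' := inf_le_left.lt_of_ne fun he => h' <|
    Submodule.eq_of_le_of_finrank_eq (inf_eq_left.1 he) (by rw [h2, (E.finrank_E₁_E₂ h3).2])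
  have hlt' := Submodule.finrank_lt_finrank_of_lt hlt
  have heq : E.E₁ = W' ⊓ E.E₂ := Submodule.eq_of_le_of_finrank_le hle (by
    rw [(E.finrank_E₁_E₂ h3).1]; omega)
  have hs := μ.sum_eq_zero
  rw [Fin.sum_univ_three] at hs
  rw [weight_plane μ h3 h2 h', ← heq, E.level_step]
  linarith

theorem weight_plane_not_ge_E₁ (μ : Weights) (h3 : Module.finrank ℂ W = 3) {W' : Submodule ℂ W}
    (h2 : Module.finrank ℂ W' = 2) (h : ¬ E.E₁ ≤ W') : E.weight μ W' = - μ.wt 0 := by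
  have h01 : E.E₁ < E.E₂ := E.strictMono (by decide)
  have hne : W' ≠ E.E₂ := fun he => h (he ▸ h01.le)
  have hsum := Submodule.finrank_sup_add_finrank_inf_eq W' E.E₂
  have hsup := Submodule.finrank_le (W' ⊔ E.E₂)
  rw [h3] at hsup
  rw [h2, (E.finrank_E₁_E₂ h3).2] at hsum
  -- The intersection has dimension at least one, so inside the line `E₁` it would be all of `E₁`.
  have hnle : ¬ W' ⊓ E.E₂ ≤ E.E₁ := fun hle => h <| by
    rw [← Submodule.eq_of_le_of_finrank_le hle (by rw [(E.finrank_E₁_E₂ h3).1]; omega)]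
    exact inf_le_left
  have hs := μ.sum_eq_zero
  rw [Fin.sum_univ_three] at hs
  rw [weight_plane μ h3 h2 hne, E.level_eq_one inf_le_right hnle]
  linarith

end Weight

end FullFlag

/-! ### Inequalities between the weights. -/

namespace Weights

theorem add_add_eq_zero (μ : Weights) : μ.wt 0 + μ.wt 1 + μ.wt 2 = 0 := by
  rw [← Fin.sum_univ_three, μ.sum_eq_zero]

theorem wt_one_le (μ : Weights) : μ.wt 1 ≤ μ.wt 0 := μ.antitone (by decide)

theorem wt_two_le (μ : Weights) : μ.wt 2 ≤ μ.wt 1 := μ.antitone (by decide)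

theorem pos_and_neg_of_ne_zero (μ : Weights) (h : μ.wt ≠ 0) : 0 < μ.wt 0 ∧ μ.wt 2 < 0 := by
  have h0 := μ.add_add_eq_zero
  have h1 := μ.wt_one_le
  have h2 := μ.wt_two_le
  by_contra hc
  apply h
  have : μ.wt 0 = 0 ∧ μ.wt 1 = 0 ∧ μ.wt 2 = 0 := by
    rw [not_and_or, not_lt, not_lt] at hc
    rcases hc with hc | hc <;> refine ⟨?_, ?_, ?_⟩ <;> linarith
  funext i
  fin_cases i <;> simp [this]

theorem wt_ne_zero (μ : Weights) (h : μ.μ₂ ≠ 0) : μ.wt ≠ 0 := fun h0 => h (congrFun h0 1)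

end Weights

/-! ### Numerical criteria for parabolic stability. -/

section Stability

variable {X : Type*} [TopologicalSpace X] [ChartedSpace ℂ X]
  {F : Type*} [NormedAddCommGroup F] [NormedSpace ℂ F]
  {V : X → Type*} [TopologicalSpace (TotalSpace F V)]
  [∀ x, AddCommGroup (V x)] [∀ x, Module ℂ (V x)] [∀ x, TopologicalSpace (V x)]
  [FiberBundle F V] {p : X}

theorem Subbundle.finrank_fiber (S : Subbundle F V) (x : X) :
    Module.finrank ℂ (S.fiber x) = S.rank := by
  obtain ⟨U, -, hx, s, hs⟩ := S.exists_frame x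
  rw [← hs.span_eq x hx, finrank_span_eq_card (hs.linearIndependent x hx), Fintype.card_fin]

theorem Subbundle.parDegree_eq (S : Subbundle F V) (E : FullFlag (V p)) (μ : Weights) :
    S.parDegree E μ = S.degree + E.weight μ (S.fiber p) := rfl

variable [VectorBundle ℂ F V]

variable (F V) in
/-- A fibre of a vector bundle is linearly isomorphic to the model fibre. -/
noncomputable def fiberEquiv (x : X) : V x ≃ₗ[ℂ] F :=
  (trivializationAt F V x).linearEquivAt ℂ x (mem_baseSet_trivializationAt F V x)

/-- The possible weights of a subbundle of rank one or two, according to its position relative to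
the flag. -/
theorem weight_cases [FiniteDimensional ℂ F] (hrank : Module.finrank ℂ F = 3)
    (E : FullFlag (V p)) {S : Subbundle F V} (h0 : 0 < S.rank) (h3 : S.rank < 3) :
    (S.rank = 1 ∧ S.fiber p = E.E₁ ∧ S.fiber p ≤ E.E₂ ∧
      ∀ μ, E.weight μ (S.fiber p) = μ.wt 0) ∨
    (S.rank = 1 ∧ S.fiber p ≠ E.E₁ ∧ S.fiber p ≤ E.E₂ ∧
      ∀ μ, E.weight μ (S.fiber p) = μ.wt 1) ∨
    (S.rank = 1 ∧ S.fiber p ≠ E.E₁ ∧ ¬ S.fiber p ≤ E.E₂ ∧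
      ∀ μ, E.weight μ (S.fiber p) = μ.wt 2) ∨
    (S.rank = 2 ∧ S.fiber p = E.E₂ ∧ E.E₁ ≤ S.fiber p ∧
      ∀ μ, E.weight μ (S.fiber p) = - μ.wt 2) ∨
    (S.rank = 2 ∧ S.fiber p ≠ E.E₂ ∧ E.E₁ ≤ S.fiber p ∧
      ∀ μ, E.weight μ (S.fiber p) = - μ.wt 1) ∨
    (S.rank = 2 ∧ S.fiber p ≠ E.E₂ ∧ ¬ E.E₁ ≤ S.fiber p ∧
      ∀ μ, E.weight μ (S.fiber p) = - μ.wt 0) := by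
  have hfin : FiniteDimensional ℂ (V p) := (fiberEquiv F V p).symm.finiteDimensional
  have hV : Module.finrank ℂ (V p) = 3 := by rw [(fiberEquiv F V p).finrank_eq, hrank]
  have h01 : E.E₁ < E.E₂ := E.strictMono (by decide)
  have hS := S.finrank_fiber p
  obtain h | h : S.rank = 1 ∨ S.rank = 2 := by omega
  · rw [h] at hS
    by_cases h1 : S.fiber p = E.E₁
    · exact .inl ⟨h, h1, h1 ▸ h01.le, fun μ => FullFlag.weight_line_eq_E₁ μ hV h1⟩
    by_cases h2 : S.fiber p ≤ E.E₂
    · exact .inr <| .inl ⟨h, h1, h2, fun μ => FullFlag.weight_line_le_E₂ μ hV hS h2 h1⟩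
    · exact .inr <| .inr <| .inl ⟨h, h1, h2, fun μ => FullFlag.weight_line_not_le_E₂ μ hS h2⟩
  · rw [h] at hS
    by_cases h1 : S.fiber p = E.E₂
    · exact .inr <| .inr <| .inr <| .inl
        ⟨h, h1, h1 ▸ h01.le, fun μ => FullFlag.weight_plane_eq_E₂ μ h1⟩
    by_cases h2 : E.E₁ ≤ S.fiber p
    · exact .inr <| .inr <| .inr <| .inr <| .inl
        ⟨h, h1, h2, fun μ => FullFlag.weight_plane_ge_E₁ μ hV hS h2 h1⟩
    · exact .inr <| .inr <| .inr <| .inr <| .inr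
        ⟨h, h1, h2, fun μ => FullFlag.weight_plane_not_ge_E₁ μ hV hS h2⟩

variable [FiniteDimensional ℂ F]

/-- The six possible values are ±μᵢ; since μ₁ ≥ 0 ≥ μ₃ and μ₁ - μ₃ < 1, all lie strictly between -1
and 1. -/
theorem abs_weight_lt_one (hrank : Module.finrank ℂ F = 3) (E : FullFlag (V p)) (μ : Weights)
    {S : Subbundle F V} (h0 : 0 < S.rank) (h3 : S.rank < 3) :
    |E.weight μ (S.fiber p)| < 1 := by
  have hs := μ.add_add_eq_zero
  have h1 := μ.wt_one_le
  have h2 := μ.wt_two_le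
  have h4 := μ.sub_lt_one
  rw [abs_lt]
  rcases weight_cases hrank E h0 h3 with h | h | h | h | h | h <;> rw [h.2.2.2 μ] <;>
    constructor <;> linarith

/-- A line subbundle of degree zero inside `E₂` at `p` prevents stability unless `μ₂ < 0`. -/
theorem exists_weight_ge_of_le_E₂ (hrank : Module.finrank ℂ F = 3) {E : FullFlag (V p)}
    (h : ∃ L ∈ degreeZeroSubbundles F V 1, L.fiber p ≤ E.E₂) :
    ∃ S : Subbundle F V, 0 < S.rank ∧ S.rank < 3 ∧ S.degree = 0 ∧
      ∀ μ : Weights, μ.μ₂ ≤ E.weight μ (S.fiber p) := by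
  obtain ⟨L, ⟨hr, hd⟩, hL⟩ := h
  refine ⟨L, by omega, by omega, hd, fun μ => ?_⟩
  have h1 := μ.wt_one_le
  rcases weight_cases hrank E (S := L) (by omega) (by omega) with h | h | h | h | h | h
  · rw [h.2.2.2 μ]; exact h1
  · rw [h.2.2.2 μ]
  · exact absurd hL h.2.2.1
  all_goals omega

/-- A rank two subbundle of degree zero containing `E₁` at `p` prevents stability unless
`0 < μ₂`. -/
theorem exists_weight_ge_of_ge_E₁ (hrank : Module.finrank ℂ F = 3) {E : FullFlag (V p)}
    (h : ∃ G ∈ degreeZeroSubbundles F V 2, E.E₁ ≤ G.fiber p) :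
    ∃ S : Subbundle F V, 0 < S.rank ∧ S.rank < 3 ∧ S.degree = 0 ∧
      ∀ μ : Weights, - μ.μ₂ ≤ E.weight μ (S.fiber p) := by
  obtain ⟨G, ⟨hr, hd⟩, hG⟩ := h
  refine ⟨G, by omega, by omega, hd, fun μ => ?_⟩
  have h2 := μ.wt_two_le
  rcases weight_cases hrank E (S := G) (by omega) (by omega) with h | h | h | h | h | h
  iterate 3 omega
  · rw [h.2.2.2 μ]; exact neg_le_neg h2
  · rw [h.2.2.2 μ]
  · exact absurd hG h.2.2.1

variable [ContMDiffVectorBundle ω F V 𝓘(ℂ, ℂ)]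

theorem isSemistable_iff (hrank : Module.finrank ℂ F = 3) (hdeg : bundleDegree F V = 0) :
    IsSemistable F V ↔ ∀ S : Subbundle F V, 0 < S.rank → S.rank < 3 → S.degree ≤ 0 := by
  have htop : (Subbundle.top F V).slope = 0 := by
    rw [bundleDegree] at hdeg
    simp [Subbundle.slope, hdeg]
  rw [IsSemistable, hrank, htop]
  refine forall_congr' fun S => imp_congr_right fun h0 => imp_congr_right fun _ => ?_
  have : (0 : ℝ) < S.rank := by exact_mod_cast h0
  rw [Subbundle.slope, div_le_iff₀ this, zero_mul]
  exact_mod_cast Iff.rfl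

theorem bundleParSlope_eq_zero (hdeg : bundleDegree F V = 0) (μ : Weights) :
    bundleParSlope F V μ = 0 := by
  simp [bundleParSlope, hdeg, μ.sum_eq_zero]

/-- Stability means that the bundle is semistable and that the degree zero subbundles have negative
weight. -/
theorem isParStable_iff (hrank : Module.finrank ℂ F = 3) (hdeg : bundleDegree F V = 0)
    (E : FullFlag (V p)) (μ : Weights) :
    IsParStable F E μ ↔ IsSemistable F V ∧ ∀ S : Subbundle F V, 0 < S.rank → S.rank < 3 →
      S.degree = 0 → E.weight μ (S.fiber p) < 0 := by
  rw [isSemistable_iff hrank hdeg, IsParStable, hrank, bundleParSlope_eq_zero hdeg,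
    ← forall_and]
  refine forall_congr' fun S => ?_
  simp only [← imp_and]
  refine imp_congr_right fun h0 => imp_congr_right fun h3 => ?_
  have hr : (0 : ℝ) < S.rank := by exact_mod_cast h0
  have hw := abs_lt.1 (abs_weight_lt_one hrank E μ h0 h3)
  rw [Subbundle.parSlope, div_lt_iff₀ hr, zero_mul, S.parDegree_eq]
  constructor
  · intro h
    refine ⟨?_, fun hd => by simpa [hd] using h⟩
    -- The weight exceeds -1, and an integer below 1 is at most 0.
    have : (S.degree : ℝ) < 1 := by linarith
    have : S.degree < 1 := by exact_mod_cast this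
    omega
  · rintro ⟨h, h'⟩
    rcases h.lt_or_eq with hlt | heq
    · have : (S.degree : ℝ) ≤ -1 := by exact_mod_cast (show S.degree ≤ -1 by omega)
      linarith
    · simpa [heq] using h' heq

/-- Parabolic semistability means that the bundle is semistable and that the degree zero subbundles
have nonpositive weight. -/
theorem isParSemistable_iff (hrank : Module.finrank ℂ F = 3) (hdeg : bundleDegree F V = 0)
    (E : FullFlag (V p)) (μ : Weights) :
    IsParSemistable F E μ ↔ IsSemistable F V ∧ ∀ S : Subbundle F V, 0 < S.rank → S.rank < 3 →
      S.degree = 0 → E.weight μ (S.fiber p) ≤ 0 := by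
  rw [isSemistable_iff hrank hdeg, IsParSemistable, hrank, bundleParSlope_eq_zero hdeg,
    ← forall_and]
  refine forall_congr' fun S => ?_
  simp only [← imp_and]
  refine imp_congr_right fun h0 => imp_congr_right fun h3 => ?_
  have hr : (0 : ℝ) < S.rank := by exact_mod_cast h0
  have hw := abs_lt.1 (abs_weight_lt_one hrank E μ h0 h3)
  rw [Subbundle.parSlope, div_le_iff₀ hr, zero_mul, S.parDegree_eq]
  constructor
  · intro h
    refine ⟨?_, fun hd => by simpa [hd] using h⟩
    have : (S.degree : ℝ) < 1 := by linarith
    have : S.degree < 1 := by exact_mod_cast this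
    omega
  · rintro ⟨h, h'⟩
    rcases h.lt_or_eq with hlt | heq
    · have : (S.degree : ℝ) ≤ -1 := by exact_mod_cast (show S.degree ≤ -1 by omega)
      linarith
    · simpa [heq] using h' heq

end Stability

end ParBundle

/-! ### The five cases and the chambers. -/

open Bundle ParBundle in
theorem mainTheorem10
    {X : Type*} [TopologicalSpace X] [ChartedSpace ℂ X] [IsManifold 𝓘(ℂ, ℂ) ω X]
    (hX : IsEllipticCurve X)
    {F : Type*} [NormedAddCommGroup F] [NormedSpace ℂ F] [FiniteDimensional ℂ F]
    (hrank : Module.finrank ℂ F = 3)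
    {V : X → Type*} [TopologicalSpace (TotalSpace F V)]
    [∀ x, AddCommGroup (V x)] [∀ x, Module ℂ (V x)] [∀ x, TopologicalSpace (V x)]
    [FiberBundle F V] [VectorBundle ℂ F V] [ContMDiffVectorBundle ω F V 𝓘(ℂ, ℂ)]
    (hdeg : bundleDegree F V = 0)
    (p : X) (E : FullFlag (V p)) :
    -- (1)
    (IsSemistable F V →
      (∀ L ∈ degreeZeroSubbundles F V 1, ¬ L.fiber p ≤ E.E₂) →
      (∀ G ∈ degreeZeroSubbundles F V 2, ¬ E.E₁ ≤ G.fiber p) →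
      ∀ μ : Weights, μ.μ₂ ≠ 0 → IsParStable F E μ) ∧
    -- (2)
    (IsSemistable F V →
      (∀ L ∈ degreeZeroSubbundles F V 1, ¬ L.fiber p ≤ E.E₂) →
      (∃ G ∈ degreeZeroSubbundles F V 2, E.E₁ ≤ G.fiber p) →
      (∀ G ∈ degreeZeroSubbundles F V 2, G.fiber p ≠ E.E₂) →
      ∀ μ : Weights, (IsParStable F E μ ↔ 0 < μ.μ₂) ∧
        (IsParStrictlySemistable F E μ ↔ μ.μ₂ = 0)) ∧
    -- (3)
    (IsSemistable F V →
      (∀ L ∈ degreeZeroSubbundles F V 1, L.fiber p ≠ E.E₁) →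
      (∃ L ∈ degreeZeroSubbundles F V 1, L.fiber p ≤ E.E₂) →
      (∀ G ∈ degreeZeroSubbundles F V 2, ¬ E.E₁ ≤ G.fiber p) →
      ∀ μ : Weights, (IsParStable F E μ ↔ μ.μ₂ < 0) ∧
        (IsParStrictlySemistable F E μ ↔ μ.μ₂ = 0)) ∧
    -- (4)
    ((∀ L ∈ degreeZeroSubbundles F V 1, L.fiber p ≠ E.E₁) →
      (∃ L ∈ degreeZeroSubbundles F V 1, L.fiber p ≤ E.E₂) →
      (∃ G ∈ degreeZeroSubbundles F V 2, E.E₁ ≤ G.fiber p) →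
      (∀ G ∈ degreeZeroSubbundles F V 2, G.fiber p ≠ E.E₂) →
      ∀ μ : Weights, (IsSemistable F V → (IsParStrictlySemistable F E μ ↔ μ.μ₂ = 0)) ∧
        (μ.μ₂ ≠ 0 → IsParUnstable F E μ)) ∧
    -- (5)
    (((∃ L ∈ degreeZeroSubbundles F V 1, L.fiber p = E.E₁) ∨
        (∃ G ∈ degreeZeroSubbundles F V 2, G.fiber p = E.E₂)) →
      ∀ μ : Weights, μ.wt ≠ 0 → IsParUnstable F E μ) ∧
    -- stability is constant on the chambers `μ₂ > 0` and `μ₂ < 0`, and there it is the same as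
    -- semistability
    (∀ μ : Weights, μ.μ₂ ≠ 0 → (IsParSemistable F E μ ↔ IsParStable F E μ)) ∧
    (∀ μ ν : Weights, ((0 < μ.μ₂ ∧ 0 < ν.μ₂) ∨ (μ.μ₂ < 0 ∧ ν.μ₂ < 0)) →
      (IsParStable F E μ ↔ IsParStable F E ν)) := by
  have hst := isParStable_iff hrank hdeg E
  have hss := isParSemistable_iff hrank hdeg E
  have hcases := fun {S : Subbundle F V} => weight_cases (S := S) hrank E
  have hne := fun (μ : Weights) (h : μ.μ₂ ≠ 0) => μ.pos_and_neg_of_ne_zero (μ.wt_ne_zero h)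
  refine ⟨?_, ?_, ?_, ?_, ?_, ?_, ?_⟩
  · intro hE hL hG μ hμ
    obtain ⟨hp, hn⟩ := hne μ hμ
    refine (hst μ).2 ⟨hE, fun S h0 h3 hd => ?_⟩
    rcases hcases h0 h3 with h | h | h | h | h | h
    · exact absurd h.2.2.1 (hL S ⟨h.1, hd⟩)
    · exact absurd h.2.2.1 (hL S ⟨h.1, hd⟩)
    · rw [h.2.2.2 μ]; exact hn
    · exact absurd h.2.2.1 (hG S ⟨h.1, hd⟩)
    · exact absurd h.2.2.1 (hG S ⟨h.1, hd⟩)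
    · rw [h.2.2.2 μ]; linarith
  · intro hE hL hG hG' μ
    obtain ⟨T, hT0, hT3, hTd, hT⟩ := exists_weight_ge_of_ge_E₁ hrank hG
    have h0' := μ.add_add_eq_zero
    have h1' := μ.wt_one_le
    have h2' := μ.wt_two_le
    have key : IsParStable F E μ ↔ 0 < μ.μ₂ := by
      constructor
      · intro h
        linarith [((hst μ).1 h).2 T hT0 hT3 hTd, hT μ]
      · intro hμ
        refine (hst μ).2 ⟨hE, fun S h0 h3 hd => ?_⟩
        rcases hcases h0 h3 with h | h | h | h | h | h
        · exact absurd h.2.2.1 (hL S ⟨h.1, hd⟩)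
        · exact absurd h.2.2.1 (hL S ⟨h.1, hd⟩)
        · rw [h.2.2.2 μ]; linarith
        · exact absurd h.2.1 (hG' S ⟨h.1, hd⟩)
        · rw [h.2.2.2 μ]; linarith
        · rw [h.2.2.2 μ]; linarith
    refine ⟨key, ?_⟩
    rw [IsParStrictlySemistable, key, not_lt]
    constructor
    · rintro ⟨h, h'⟩
      linarith [((hss μ).1 h).2 T hT0 hT3 hTd, hT μ]
    · intro hμ
      refine ⟨(hss μ).2 ⟨hE, fun S h0 h3 hd => ?_⟩, hμ.le⟩
      rcases hcases h0 h3 with h | h | h | h | h | h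
      · exact absurd h.2.2.1 (hL S ⟨h.1, hd⟩)
      · exact absurd h.2.2.1 (hL S ⟨h.1, hd⟩)
      · rw [h.2.2.2 μ]; linarith
      · exact absurd h.2.1 (hG' S ⟨h.1, hd⟩)
      · rw [h.2.2.2 μ]; linarith
      · rw [h.2.2.2 μ]; linarith
  · intro hE hL' hL hG μ
    obtain ⟨T, hT0, hT3, hTd, hT⟩ := exists_weight_ge_of_le_E₂ hrank hL
    have h0' := μ.add_add_eq_zero
    have h1' := μ.wt_one_le
    have h2' := μ.wt_two_le
    have key : IsParStable F E μ ↔ μ.μ₂ < 0 := by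
      constructor
      · intro h
        linarith [((hst μ).1 h).2 T hT0 hT3 hTd, hT μ]
      · intro hμ
        refine (hst μ).2 ⟨hE, fun S h0 h3 hd => ?_⟩
        rcases hcases h0 h3 with h | h | h | h | h | h
        · exact absurd h.2.1 (hL' S ⟨h.1, hd⟩)
        · rw [h.2.2.2 μ]; linarith
        · rw [h.2.2.2 μ]; linarith
        · exact absurd h.2.2.1 (hG S ⟨h.1, hd⟩)
        · exact absurd h.2.2.1 (hG S ⟨h.1, hd⟩)
        · rw [h.2.2.2 μ]; linarith
    refine ⟨key, ?_⟩
    rw [IsParStrictlySemistable, key, not_lt]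
    constructor
    · rintro ⟨h, h'⟩
      linarith [((hss μ).1 h).2 T hT0 hT3 hTd, hT μ]
    · intro hμ
      refine ⟨(hss μ).2 ⟨hE, fun S h0 h3 hd => ?_⟩, hμ.ge⟩
      rcases hcases h0 h3 with h | h | h | h | h | h
      · exact absurd h.2.1 (hL' S ⟨h.1, hd⟩)
      · rw [h.2.2.2 μ]; linarith
      · rw [h.2.2.2 μ]; linarith
      · exact absurd h.2.2.1 (hG S ⟨h.1, hd⟩)
      · exact absurd h.2.2.1 (hG S ⟨h.1, hd⟩)
      · rw [h.2.2.2 μ]; linarith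
  · intro hL' hL hG hG' μ
    obtain ⟨T, hT0, hT3, hTd, hT⟩ := exists_weight_ge_of_le_E₂ hrank hL
    obtain ⟨T', hT0', hT3', hTd', hT'⟩ := exists_weight_ge_of_ge_E₁ hrank hG
    -- The line subbundle forces μ₂ ≤ 0 and the plane subbundle forces -μ₂ ≤ 0.
    have hzero : IsParSemistable F E μ → μ.μ₂ = 0 := fun h => by
      have h1 := ((hss μ).1 h).2 T hT0 hT3 hTd
      have h2 := ((hss μ).1 h).2 T' hT0' hT3' hTd'
      linarith [hT μ, hT' μ]
    refine ⟨fun hE => ⟨fun h => hzero h.1, fun hμ => ⟨?_, fun h => ?_⟩⟩, fun hμ h => hμ (hzero h)⟩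
    · have h0' := μ.add_add_eq_zero
      have h1' := μ.wt_one_le
      have h2' := μ.wt_two_le
      refine (hss μ).2 ⟨hE, fun S h0 h3 hd => ?_⟩
      rcases hcases h0 h3 with h | h | h | h | h | h
      · exact absurd h.2.1 (hL' S ⟨h.1, hd⟩)
      · rw [h.2.2.2 μ]; linarith
      · rw [h.2.2.2 μ]; linarith
      · exact absurd h.2.1 (hG' S ⟨h.1, hd⟩)
      · rw [h.2.2.2 μ]; linarith
      · rw [h.2.2.2 μ]; linarith
    · linarith [((hst μ).1 h).2 T hT0 hT3 hTd, hT μ]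
  · rintro h μ hμ hsemi
    obtain ⟨hp, hn⟩ := μ.pos_and_neg_of_ne_zero hμ
    have hle := ((hss μ).1 hsemi).2
    rcases h with ⟨S, ⟨hr, hd⟩, hS⟩ | ⟨S, ⟨hr, hd⟩, hS⟩
    · have hw := hle S (by omega) (by omega) hd
      rcases hcases (S := S) (by omega) (by omega) with h | h | h | h | h | h
      · rw [h.2.2.2 μ] at hw; linarith
      · exact h.2.1 hS
      · exact h.2.1 hS
      all_goals omega
    · have hw := hle S (by omega) (by omega) hd
      rcases hcases (S := S) (by omega) (by omega) with h | h | h | h | h | h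
      iterate 3 omega
      · rw [h.2.2.2 μ] at hw; linarith
      · exact h.2.1 hS
      · exact h.2.1 hS
  · intro μ hμ
    obtain ⟨hp, hn⟩ := hne μ hμ
    rw [hst μ, hss μ]
    refine and_congr_right fun _ => forall_congr' fun S => forall_congr' fun h0 =>
      forall_congr' fun h3 => imp_congr_right fun _ => ?_
    -- Off the wall none of the six possible weights vanishes, so weak and strict inequality agree.
    refine ⟨fun hle => hle.lt_of_ne ?_, le_of_lt⟩
    rcases hcases h0 h3 with h | h | h | h | h | h <;> rw [h.2.2.2 μ]
    · exact hp.ne'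
    · exact hμ
    · exact hn.ne
    · exact neg_ne_zero.2 hn.ne
    · exact neg_ne_zero.2 hμ
    · exact neg_ne_zero.2 hp.ne'
  · intro μ ν hμν
    have hμ : μ.μ₂ ≠ 0 := by rcases hμν with h | h; exacts [h.1.ne', h.1.ne]
    have hν : ν.μ₂ ≠ 0 := by rcases hμν with h | h; exacts [h.2.ne', h.2.ne]
    obtain ⟨hp, hn⟩ := hne μ hμ
    obtain ⟨hp', hn'⟩ := hne ν hν
    rw [hst μ, hst ν]
    refine and_congr_right fun _ => forall_congr' fun S => forall_congr' fun h0 =>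
      forall_congr' fun h3 => imp_congr_right fun _ => ?_
    -- In each position the weights for `μ` and `ν` have the same sign.
    rcases hcases h0 h3 with h | h | h | h | h | h <;> rw [h.2.2.2 μ, h.2.2.2 ν] <;>
      rcases hμν with h' | h' <;> constructor <;> intro _ <;> linarith
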